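/- Let $Z,Z_1,Z_2,\dots$ be i.i.d. $\mathbb Z$-valued random variables with distribution $(q_k)_{k\in\mathbb Z}$, $\mathbb E Z^+<\infty$ and $\mathbb P(Z<0)>0$; let $\beta\in(0,1)$ and $\gamma\in(0,1)$. Put $A(x)=\{0,\dots,x\}$ for $x\ge 0$ and $A(x)=\{0\}$ for $x<0$, and $D=\{(x,a): x\in\mathbb Z,\ a\in A(x)\}$. The surplus evolves by $x_{n+1}=x_n-a_n+Z_{n+1}$ if $x_n\ge 0$ and $x_{n+1}=x_n$ if $x_n<0$, where $a_n\in A(x_n)$ is the dividend paid at time $n$. A policy $\pi=(\pi_k)_{k\ge0}$ consists of maps $\pi_k:D^k\times\mathbb Z\to\mathbb N_0$ with $\pi_k(x_0,a_0,\dots,x_k)\in A(x_k)$; $\Pi$ is the set of all policies, and $\mathbb P_x^\pi$, with expectation $\mathbb E_x^\pi$, is the law on $D^\infty$ of the process $(x_k,a_k)_{k\ge0}$ with $x_0=x$ controlled by $\pi$. Let $\tau=\inf\{n: x_n<0\}$. For $x\in\mathbb Z$ and $y\ge0$ define $$\widehat J_\pi(x)=\mathbb E_x^\pi\Big(\sum_{k=0}^\infty\beta^k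 a_k\Big)^\gamma,\quad \widehat J(x)=\sup_{\pi\in\Pi}\widehat J_\pi(x),\quad J(x,y)=\sup_{\pi\in\Pi}\mathbb E_x^\pi\Big(\sum_{k=0}^{\tau-1}\beta^k a_k+y\Big)^\gamma,$$ $$G(x,y)=\sum_{k\in\mathbb Z}J(x+k,y)\,q_k .$$ For $x\ge0$ let $f^*(x,y)$ be the largest maximiser of $a\mapsto\beta^\gamma G\big(x-a,\tfrac{a+y}{\beta}\big)$ over $a\in A(x)$, and let $f^*(x,y)=0$ for $x<0$. Let $\pi^*$ be the policy $\pi^*_k(x_0,a_0,\dots,x_k)=f^*(x_k,y_k)$, where $y_0=0$ and $y_{k+1}=(y_k+a_k)/\beta$. Then $\pi^*$ is optimal for the original power-utility dividend problem: for every $x\in\mathbb Z$, $$\widehat J(x)=\widehat J_{\pi^*}(x)<\infty .$$ Moreover, $\pi^*$ depends on the history only through the current surplus and the accumulated discounted dividends: on every history, $\pi_k^*(x_0,a_0,\dots,x_k)=f^*(x_k,y_k)$ with $y_k=\beta^{-k}\sum_{m=0}^{k-1}\beta^m a_m$; and $\mathbb P_x^{\pi^*}$-almost surely, for all $k\ge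 0$, $a_k=f^*(x_k,y_k)$ and $y_{k+1}=(y_k+f^*(x_k,y_k))/\beta$. -/

import Mathlib

open MeasureTheory ProbabilityTheory
open scoped ENNReal NNReal

noncomputable section

namespace Dividend

/-- The admissible dividends `A(x)`: `{0, …, x}` for `x ≥ 0` and `{0}` for `x < 0`. -/
def actions (x : ℤ) : Finset ℕ := Finset.range (x.toNat + 1)

/-- The set `D` of admissible pairs (surplus, dividend), with its discrete σ-algebra. -/
abbrev AdmPair : Type := {p : ℤ × ℕ // p.2 ∈ actions p.1}

/-- A (deterministic, history-dependent) policy. The history `ω_k = (x₀, a₀, …, x_k)` in `D^k × ℤ`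
is split into the past pairs `h : Fin k → D` and the current surplus `x = x_k`. -/
structure Policy where
  act : (k : ℕ) → (Fin k → AdmPair) → ℤ → ℕ
  act_mem : ∀ k h x, act k h x ∈ actions x

/-- The law `q(· | x, a)` of the next surplus: `x - a + Z` with `Z ∼ q` if `x ≥ 0`,
and `x` itself after ruin. -/
def trans (q : PMF ℤ) (p : AdmPair) : PMF ℤ :=
  if 0 ≤ p.1.1 then q.map (fun k => p.1.1 - (p.1.2 : ℤ) + k) else PMF.pure p.1.1

/-- The pair (surplus, dividend) at time `k`, given the past and the surplus `x`. -/
def Policy.pair (π : Policy) (k : ℕ) (h : Fin k → AdmPair) (x : ℤ) : AdmPair :=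
  ⟨(x, π.act k h x), π.act_mem k h x⟩

/-- The past pairs at times `0, …, n`, reindexed by `Fin (n + 1)`. -/
def reindex {n : ℕ} (h : (i : Finset.Iic n) → AdmPair) : Fin (n + 1) → AdmPair :=
  fun i => h ⟨i, Finset.mem_Iic.2 (Nat.lt_succ_iff.1 i.2)⟩

/-- The one-step kernel: given `(x₀, a₀, …, x_n, a_n)`, draw `x_{n+1} ∼ q(· | x_n, a_n)` and let
the policy choose `a_{n+1}`. -/
def stepKernel (q : PMF ℤ) (π : Policy) (n : ℕ) :
    Kernel ((i : Finset.Iic n) → AdmPair) AdmPair where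
  toFun h := ((trans q (h ⟨n, Finset.mem_Iic.2 le_rfl⟩)).map
    (π.pair (n + 1) (reindex h))).toMeasure
  measurable' := Measurable.of_discrete

instance stepKernel_isMarkov (q : PMF ℤ) (π : Policy) (n : ℕ) : IsMarkovKernel (stepKernel q π n) where
  isProbabilityMeasure h :=
    inferInstanceAs (IsProbabilityMeasure ((trans q (h ⟨n, Finset.mem_Iic.2 le_rfl⟩)).map
      (π.pair (n + 1) (reindex h))).toMeasure)

/-- The measure `ℙ_x^π` on `D^∞` (Ionescu-Tulcea) for the initial surplus `x` and the policy `π`. -/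
def law (q : PMF ℤ) (π : Policy) (x : ℤ) : Measure (ℕ → AdmPair) :=
  Kernel.traj (X := fun _ => AdmPair) (stepKernel q π) 0 (fun _ => π.pair 0 Fin.elim0 x)

/-- The surplus `x_k` along a trajectory. -/
def surplus (ω : ℕ → AdmPair) (k : ℕ) : ℤ := (ω k).1.1

/-- The dividend `a_k` along a trajectory. -/
def dividend (ω : ℕ → AdmPair) (k : ℕ) : ℕ := (ω k).1.2

/-- The ruin time `τ`, the first `n` with `x_n < 0` (and `⊤` if there is none). -/
def ruin (ω : ℕ → AdmPair) : ℕ∞ := ⨅ (n : ℕ) (_ : surplus ω n < 0), (n : ℕ∞)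

variable (q : PMF ℤ) (β : ℝ≥0) (γ : ℝ)

/-- `Ĵ_π(x) = 𝔼_x^π (∑_{k ≥ 0} β^k a_k)^γ`, the expected power utility of discounted dividends. -/
def JhatPol (π : Policy) (x : ℤ) : ℝ≥0∞ :=
  ∫⁻ ω, (∑' k, (β : ℝ≥0∞) ^ k * (dividend ω k : ℝ≥0∞)) ^ γ ∂(law q π x)

/-- The value function `Ĵ(x) = sup_π Ĵ_π(x)` of the original problem. -/
def Jhat (x : ℤ) : ℝ≥0∞ := ⨆ π : Policy, JhatPol q β γ π x

open scoped Classical in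
/-- `J_π(x, y) = 𝔼_x^π (∑_{k < τ} β^k a_k + y)^γ`. -/
def JPol (π : Policy) (x : ℤ) (y : ℝ≥0) : ℝ≥0∞ :=
  ∫⁻ ω, ((∑' k : ℕ, if (k : ℕ∞) < ruin ω then (β : ℝ≥0∞) ^ k * (dividend ω k : ℝ≥0∞) else 0)
    + (y : ℝ≥0∞)) ^ γ ∂(law q π x)

/-- The value function `J(x, y) = sup_π J_π(x, y)` on the extended state space. -/
def J (x : ℤ) (y : ℝ≥0) : ℝ≥0∞ := ⨆ π : Policy, JPol q β γ π x y

/-- `G(x, y) = ∑_{k ∈ ℤ} J(x + k, y) q_k`. -/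
def G (x : ℤ) (y : ℝ≥0) : ℝ≥0∞ := ∑' k : ℤ, J q β γ (x + k) y * q k

/-- The function `a ↦ β^γ G(x - a, (a + y) / β)` maximised in the optimality equation. -/
def bellman (x : ℤ) (y : ℝ≥0) (a : ℕ) : ℝ≥0∞ :=
  (β : ℝ≥0∞) ^ γ * G q β γ (x - a) ((a + y) / β)

open scoped Classical in
/-- `f*(x, y)`: the largest maximiser of `a ↦ β^γ G(x - a, (a + y) / β)` over `A(x)`.
For `x < 0` the value is `0`, since `A(x) = {0}`. -/
def fStar (x : ℤ) (y : ℝ≥0) : ℕ :=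
  ((actions x).filter (fun a => ∀ b ∈ actions x, bellman q β γ x y b ≤ bellman q β γ x y a)).sup id

variable {q β γ} in
lemma fStar_mem (x : ℤ) (y : ℝ≥0) : fStar q β γ x y ∈ actions x := by
  refine Finset.mem_range.2 ?_
  refine (Finset.sup_lt_iff (Nat.succ_pos _)).2 fun b hb => ?_
  exact Finset.mem_range.1 (Finset.mem_filter.1 hb).1

/-- The second component `y_k` along a history: `y_0` is given and `y_{k+1} = (y_k + a_k) / β`. -/
def accum (y₀ : ℝ≥0) : (k : ℕ) → (Fin k → AdmPair) → ℝ≥0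
  | 0, _ => y₀
  | k + 1, h => (accum y₀ k (fun i => h i.castSucc) + ((h (Fin.last k)).1.2 : ℝ≥0)) / β

/-- The policy `π*` started from `y₀`: at time `k` pay `f*(x_k, y_k)`. -/
def piStar (y₀ : ℝ≥0) : Policy where
  act k h x := fStar q β γ x (accum β y₀ k h)
  act_mem _ _ _ := fStar_mem _ _

end Dividend

end

open MeasureTheory ProbabilityTheory
open scoped ENNReal NNReal

noncomputable section

namespace Dividend

/-! ### One-step disintegration and time shift for the law of the controlled process. -/

section

/-! Only `Jhat ≤ JhatPol piStar` needs work, the reverse being the definition of the supremum.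
Conditioning on the first step gives half of the optimality equation, J(x,y) ≤ max_a β^γ
G(x-a,(a+y)/β) for x ≥ 0 (`J_le_bellman_fStar`); the other half, which would require pasting
near-optimal policies, is never used.

Since π* plays a maximiser, iteration yields Ĵ(x) ≤ E β^{γn} J(x_n,y_n) under π*
(`Jhat_le_lintegral_J`). Subadditivity of u^γ gives J(x,y) ≤ y^γ + Ĵ(x), and β^n y_n is the
discounted dividend total before time n, so Ĵ(x) ≤ Ĵ_{π*}(x) + β^{γn} E Ĵ(x_n).

The remainder vanishes: Ĵ grows at most linearly in x⁺ (`Jhat_le`) and E x_n⁺ at most linearly in n.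
The same bound gives finiteness. -/

/-- The pairs at times `0, …, n - 1` along a trajectory. -/
def history (n : ℕ) (ω : ℕ → AdmPair) : Fin n → AdmPair := fun i => ω i

lemma measurable_history (n : ℕ) : Measurable (history n) :=
  measurable_pi_lambda _ fun _ => measurable_pi_apply _

lemma measurable_comp_history {α : Type*} [MeasurableSpace α] (n : ℕ)
    (g : (Fin n → AdmPair) → α) : Measurable fun ω => g (history n ω) :=
  Measurable.of_discrete.comp (measurable_history n)

instance law_isProbabilityMeasure (q : PMF ℤ) (π : Policy) (x : ℤ) :
    IsProbabilityMeasure (law q π x) := by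
  unfold law; infer_instance

lemma lintegral_map_toMeasure {α : Type*} [MeasurableSpace α] [MeasurableSingletonClass α]
    (p : PMF ℤ) (f : ℤ → α) (g : α → ℝ≥0∞) (hg : Measurable g) :
    ∫⁻ a, g a ∂(p.map f).toMeasure = ∑' k, p k * g (f k) := by
  rw [← PMF.toMeasure_map f p Measurable.of_discrete, lintegral_map hg Measurable.of_discrete,
    lintegral_countable']
  refine tsum_congr fun k => ?_
  rw [PMF.toMeasure_apply_singleton _ _ (measurableSet_singleton k), mul_comm]

lemma tsum_map_mul (p : PMF ℤ) (f g : ℤ → ℝ≥0∞) (e : ℤ → ℤ) (hg : g = fun k => f (e k)) :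
    ∑' j, (p.map e) j * f j = ∑' k, p k * g k := by
  subst hg
  rw [← lintegral_map_toMeasure p e f Measurable.of_discrete, lintegral_countable']
  refine tsum_congr fun k => ?_
  rw [PMF.toMeasure_apply_singleton _ _ (measurableSet_singleton k), mul_comm]

variable (q : PMF ℤ) (π : Policy) (x : ℤ)

lemma lintegral_law_zero (g : AdmPair → ℝ≥0∞) :
    ∫⁻ ω, g (ω 0) ∂(law q π x) = g (π.pair 0 Fin.elim0 x) := by
  have h := Kernel.traj_map_frestrictLe_apply (X := fun _ => AdmPair)
    (κ := stepKernel q π) 0 0 (fun _ => π.pair 0 Fin.elim0 x)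
  have h2 : ∫⁻ ω, g (ω 0) ∂(law q π x) =
      ∫⁻ h, g (h ⟨0, Finset.mem_Iic.2 le_rfl⟩)
        ∂((law q π x).map (Preorder.frestrictLe (π := fun _ => AdmPair) 0)) := by
    rw [lintegral_map Measurable.of_discrete (by fun_prop)]
    rfl
  rw [h2, law, h, Kernel.partialTraj_self, Kernel.id_apply, lintegral_dirac]

/-- The one-step disintegration of the law of the controlled process. -/
lemma lintegral_law_succ (n : ℕ) (g : (Fin (n + 1) → AdmPair) → AdmPair → ℝ≥0∞) :
    ∫⁻ ω, g (history (n + 1) ω) (ω (n + 1)) ∂(law q π x) =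
      ∫⁻ ω, ∑' k, trans q (ω n) k *
        g (history (n + 1) ω) (π.pair (n + 1) (history (n + 1) ω) k) ∂(law q π x) := by
  have h := fun m => Kernel.traj_map_frestrictLe_apply (X := fun _ => AdmPair)
    (κ := stepKernel q π) 0 m (fun _ => π.pair 0 Fin.elim0 x)
  let Φ (h : (i : Finset.Iic (n + 1)) → AdmPair) : ℝ≥0∞ :=
    g (fun i => h ⟨i, Finset.mem_Iic.2 i.2.le⟩) (h ⟨n + 1, Finset.mem_Iic.2 le_rfl⟩)
  have hΦ : Measurable Φ := Measurable.of_discrete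
  have h1 : ∫⁻ ω, g (history (n + 1) ω) (ω (n + 1)) ∂(law q π x) =
      ∫⁻ h, Φ h ∂((law q π x).map (Preorder.frestrictLe (π := fun _ => AdmPair) (n + 1))) := by
    rw [lintegral_map Measurable.of_discrete (by fun_prop)]
    rfl
  have h2 : ∫⁻ ω, ∑' k, trans q (ω n) k *
        g (history (n + 1) ω) (π.pair (n + 1) (history (n + 1) ω) k) ∂(law q π x) =
      ∫⁻ h, ∑' k, trans q (h ⟨n, Finset.mem_Iic.2 le_rfl⟩) k *
        g (reindex h) (π.pair (n + 1) (reindex h) k)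
        ∂((law q π x).map (Preorder.frestrictLe (π := fun _ => AdmPair) n)) := by
    rw [lintegral_map Measurable.of_discrete (by fun_prop)]
    rfl
  have hI : Measurable (IicProdIoc (X := fun _ => AdmPair) n (n + 1)) := measurable_IicProdIoc
  have hΦI : Measurable fun a => Φ (IicProdIoc (X := fun _ => AdmPair) n (n + 1) a) := hΦ.comp hI
  have hΦIh : ∀ h, Measurable fun a => Φ (IicProdIoc (X := fun _ => AdmPair) n (n + 1) (h, a)) :=
    fun h => hΦI.comp measurable_prodMk_left
  rw [h1, h2, law, h, h, Kernel.partialTraj_succ_of_le (Nat.zero_le n),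
    Kernel.map_apply _ hI, lintegral_map hΦ hI,
    Kernel.lintegral_comp _ _ _ hΦI]
  refine lintegral_congr fun h => ?_
  rw [Kernel.lintegral_prod _ _ _ hΦI,
    Kernel.id_apply, lintegral_dirac,
    Kernel.map_apply _ (MeasurableEquiv.measurable _), lintegral_map (hΦIh h)
      (MeasurableEquiv.measurable _)]
  change ∫⁻ a, _ ∂(PMF.toMeasure _) = _
  rw [lintegral_map_toMeasure _ _ _ Measurable.of_discrete]
  refine tsum_congr fun k => ?_
  congr 1
  refine congrArg₂ g (funext fun i => ?_) ?_
  · simp [IicProdIoc, reindex, Nat.lt_succ_iff.1 i.2]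
  · simp [IicProdIoc, MeasurableEquiv.piSingleton]

lemma ae_law_zero : ∀ᵐ ω ∂(law q π x), ω 0 = π.pair 0 Fin.elim0 x := by
  classical
  have h := lintegral_law_zero q π x fun p => if p = π.pair 0 Fin.elim0 x then 0 else 1
  have hm : Measurable fun ω : ℕ → AdmPair =>
      if ω 0 = π.pair 0 Fin.elim0 x then (0 : ℝ≥0∞) else 1 :=
    (Measurable.of_discrete (f := fun p : AdmPair => if p = π.pair 0 Fin.elim0 x then
      (0 : ℝ≥0∞) else 1)).comp (measurable_pi_apply 0)
  rw [if_pos rfl, lintegral_eq_zero_iff hm] at h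
  filter_upwards [h] with ω hω
  by_contra hne
  simp [hne] at hω

/-- The indicator of failure has integral zero, because it vanishes along every transition of
positive mass. -/
lemma ae_law_succ (n : ℕ) (P : (Fin (n + 1) → AdmPair) → AdmPair → Prop)
    (hP : ∀ h k, trans q (h (Fin.last n)) k ≠ 0 → P h (π.pair (n + 1) h k)) :
    ∀ᵐ ω ∂(law q π x), P (history (n + 1) ω) (ω (n + 1)) := by
  classical
  have h := lintegral_law_succ q π x n fun h p => if P h p then 0 else 1
  have h0 : ∀ ω : ℕ → AdmPair, ∑' k, trans q (ω n) k *
      (if P (history (n + 1) ω) (π.pair (n + 1) (history (n + 1) ω) k)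
        then (0 : ℝ≥0∞) else 1) = 0 := by
    intro ω
    rw [ENNReal.tsum_eq_zero]
    intro k
    by_cases hk : trans q (ω n) k = 0
    · simp [hk]
    · rw [if_pos (hP (history (n + 1) ω) k hk), mul_zero]
  simp only [h0, lintegral_zero] at h
  have hm : Measurable fun ω => if P (history (n + 1) ω) (ω (n + 1)) then (0 : ℝ≥0∞) else 1 :=
    measurable_comp_history (n + 2)
      fun h => if P (fun i => h i.castSucc) (h (Fin.last _)) then (0 : ℝ≥0∞) else 1
  rw [lintegral_eq_zero_iff hm] at h
  filter_upwards [h] with ω hω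
  by_contra hne
  simp [hne] at hω

lemma ae_law_eq_pair (n : ℕ) :
    ∀ᵐ ω ∂(law q π x), ω n = π.pair n (history n ω) (surplus ω n) := by
  cases n with
  | zero =>
    filter_upwards [ae_law_zero q π x] with ω hω
    have h : history 0 ω = Fin.elim0 := Subsingleton.elim _ _
    rw [surplus, hω, h]
    rfl
  | succ n =>
    exact ae_law_succ q π x n (fun h p => p = π.pair (n + 1) h p.1.1) fun h k _ => rfl

/-- The policy followed from time `1` on, when the pair at time `0` is `p`. -/
def Policy.shift (π : Policy) (p : AdmPair) : Policy where
  act k h x := π.act (k + 1) (Fin.cons p h) x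
  act_mem _ _ _ := π.act_mem _ _ _

lemma Policy.shift_pair (p : AdmPair) (k : ℕ) (h : Fin k → AdmPair) (y : ℤ) :
    (π.shift p).pair k h y = π.pair (k + 1) (Fin.cons p h) y := rfl

/-- The trajectory from time `1` on, given `x₁`, follows the law of the shifted policy. -/
lemma lintegral_law_shift (n : ℕ) (g : (Fin (n + 1) → AdmPair) → ℝ≥0∞) :
    ∫⁻ ω, g (history (n + 1) fun i => ω (i + 1)) ∂(law q π x) =
      ∑' k, trans q (π.pair 0 Fin.elim0 x) k *
        ∫⁻ ω, g (history (n + 1) ω) ∂(law q (π.shift (π.pair 0 Fin.elim0 x)) k) := by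
  set p := π.pair 0 Fin.elim0 x with hp
  have hcons : ∀ (m : ℕ) (ω : ℕ → AdmPair), ω 0 = p →
      history (m + 1) ω = Fin.cons p (history m fun i => ω (i + 1)) := by
    intro m ω hω
    funext i
    refine Fin.cases ?_ (fun i => ?_) i
    · simpa [history] using hω
    · simp [history]
  induction n with
  | zero =>
    have h0 : ∀ ω : ℕ → AdmPair, history 1 ω = fun _ => ω 0 := fun ω => by
      funext i
      simp [history, Subsingleton.elim i 0]
    simp only [h0]
    rw [lintegral_law_succ q π x 0 fun _ r => g fun _ => r]
    have : ∀ᵐ ω ∂(law q π x), ∑' k, trans q (ω 0) k *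
        g (fun _ => π.pair 1 (history 1 ω) k) = ∑' k, trans q p k *
          g (fun _ => (π.shift p).pair 0 Fin.elim0 k) := by
      filter_upwards [ae_law_zero q π x] with ω hω
      rw [hω, ← hp]
      simp only [Policy.shift_pair]
      rw [hcons 0 ω hω, Subsingleton.elim (history 0 _) Fin.elim0]
    rw [lintegral_congr_ae this, lintegral_const, measure_univ, mul_one]
    refine tsum_congr fun k => ?_
    rw [lintegral_law_zero q (π.shift p) k fun r => g fun _ => r]
  | succ n ih =>
    have hsnoc : ∀ ω : ℕ → AdmPair,
        history (n + 2) ω = Fin.snoc (history (n + 1) ω) (ω (n + 1)) := by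
      intro ω
      funext i
      refine Fin.lastCases ?_ (fun i => ?_) i
      · simp [history]
      · simp [history]
    -- Integrating out the last pair on either side leaves this same functional of one coordinate
    -- fewer, to which the induction hypothesis applies.
    let G (h : Fin (n + 1) → AdmPair) : ℝ≥0∞ := ∑' k, trans q (h (Fin.last n)) k *
      g (Fin.snoc h ((π.shift p).pair (n + 1) h k))
    have hR : ∀ k, ∫⁻ ω, g (history (n + 2) ω) ∂(law q (π.shift p) k) =
        ∫⁻ ω, G (history (n + 1) ω) ∂(law q (π.shift p) k) := by
      intro k
      simp only [hsnoc]
      rw [lintegral_law_succ q (π.shift p) k n fun h r => g (Fin.snoc h r)]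
      rfl
    simp only [hR]
    rw [← ih G]
    have hL := lintegral_law_succ q π x (n + 1) fun h r => g (Fin.snoc (Fin.tail h) r)
    have ht : ∀ ω : ℕ → AdmPair, Fin.tail (history (n + 1 + 1) ω) =
        history (n + 1) fun i => ω (i + 1) := fun ω => by
      funext i
      simp [history, Fin.tail]
    simp only [ht] at hL
    simp only [hsnoc]
    rw [hL]
    refine lintegral_congr_ae ?_
    filter_upwards [ae_law_zero q π x] with ω hω
    simp only [G, Policy.shift_pair]
    rw [hcons (n + 1) ω hω]
    rfl

end

/-! ### Absorption at ruin and the upper half of the optimality equation. -/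

section

variable (q : PMF ℤ) (β : ℝ≥0) (γ : ℝ) (π : Policy)

lemma dividend_eq_zero_of_surplus_neg {ω : ℕ → AdmPair} {n : ℕ} (h : surplus ω n < 0) :
    dividend ω n = 0 := by
  have h2 := (ω n).2
  have h3 : (ω n).1.1 < 0 := h
  simp only [actions, Finset.mem_range] at h2
  simp only [dividend]
  omega

lemma dividend_le_surplus (ω : ℕ → AdmPair) (n : ℕ) :
    dividend ω n ≤ (surplus ω n).toNat :=
  Nat.lt_succ_iff.1 (Finset.mem_range.1 (ω n).2)

lemma trans_of_nonneg {p : AdmPair} (hp : 0 ≤ p.1.1) :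
    trans q p = q.map (fun k => p.1.1 - (p.1.2 : ℤ) + k) := if_pos hp

lemma trans_of_neg {p : AdmPair} (hp : p.1.1 < 0) : trans q p = PMF.pure p.1.1 :=
  if_neg hp.not_ge

lemma tsum_trans_mul_of_nonneg {p : AdmPair} (hp : 0 ≤ p.1.1) (f : ℤ → ℝ≥0∞) :
    ∑' j, trans q p j * f j = ∑' k, q k * f (p.1.1 - (p.1.2 : ℤ) + k) := by
  rw [trans_of_nonneg q hp]
  exact tsum_map_mul q f _ _ rfl

lemma tsum_trans_mul_of_neg {p : AdmPair} (hp : p.1.1 < 0) (f : ℤ → ℝ≥0∞) :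
    ∑' j, trans q p j * f j = f p.1.1 := by
  rw [trans_of_neg q hp, tsum_eq_single p.1.1]
  · simp
  · intro j hj
    simp [PMF.pure_apply, hj]

lemma ae_surplus_succ_of_neg (x : ℤ) :
    ∀ᵐ ω ∂(law q π x), ∀ n, surplus ω n < 0 → surplus ω (n + 1) = surplus ω n := by
  refine ae_all_iff.2 fun n => ?_
  refine ae_law_succ q π x n (fun h p => (h (Fin.last n)).1.1 < 0 →
    p.1.1 = (h (Fin.last n)).1.1) fun h k hk hneg => ?_
  by_contra hne
  refine hk ?_
  rw [trans_of_neg q hneg, PMF.pure_apply]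
  exact if_neg hne

lemma ae_surplus_neg_of_le (x : ℤ) :
    ∀ᵐ ω ∂(law q π x), ∀ n m, n ≤ m → surplus ω n < 0 → surplus ω m < 0 := by
  filter_upwards [ae_surplus_succ_of_neg q π x] with ω hω n m hnm hn
  induction m, hnm using Nat.le_induction with
  | base => exact hn
  | succ m _ ih => rwa [hω m ih]

/-- Negative surplus is absorbing and admits only the dividend 0, so truncating the dividend sum at
ruin loses nothing. -/
lemma ae_dividend_eq_zero_of_ruin_le (x : ℤ) :
    ∀ᵐ ω ∂(law q π x), ∀ k : ℕ, ¬ (k : ℕ∞) < ruin ω → dividend ω k = 0 := by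
  filter_upwards [ae_surplus_neg_of_le q π x] with ω hω k hk
  refine dividend_eq_zero_of_surplus_neg ?_
  by_contra hneg
  refine hk ?_
  have h : ((k + 1 : ℕ) : ℕ∞) ≤ ruin ω := by
    refine le_iInf₂ fun n hn => ?_
    have hkn : k < n := by
      by_contra hle
      exact hneg (hω n k (not_lt.1 hle) hn)
    exact_mod_cast hkn
  refine lt_of_lt_of_le ?_ h
  exact_mod_cast Nat.lt_succ_self k

/-- The discounted dividends paid at times `0, …, n - 1`. -/
def discounted (n : ℕ) (ω : ℕ → AdmPair) : ℝ≥0∞ :=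
  ∑ k ∈ Finset.range n, (β : ℝ≥0∞) ^ k * (dividend ω k : ℝ≥0∞)

lemma measurable_dividend (k : ℕ) : Measurable fun ω => (dividend ω k : ℝ≥0∞) :=
  (Measurable.of_discrete (f := fun p : AdmPair => (p.1.2 : ℝ≥0∞))).comp (measurable_pi_apply k)

lemma measurable_discounted (n : ℕ) : Measurable (discounted β n) :=
  Finset.measurable_sum _ fun k _ => (measurable_dividend k).const_mul _

lemma discounted_mono (ω : ℕ → AdmPair) : Monotone fun n => discounted β n ω :=
  fun _ _ h => Finset.sum_le_sum_of_subset (Finset.range_mono h)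

lemma tsum_eq_iSup_discounted (ω : ℕ → AdmPair) :
    ∑' k, (β : ℝ≥0∞) ^ k * (dividend ω k : ℝ≥0∞) = ⨆ n, discounted β n ω :=
  ENNReal.tsum_eq_iSup_nat

lemma discounted_succ (n : ℕ) (ω : ℕ → AdmPair) :
    discounted β (n + 1) ω =
      dividend ω 0 + β * discounted β n fun i => ω (i + 1) := by
  rw [discounted, Finset.sum_range_succ', discounted, Finset.mul_sum, add_comm]
  congr 1
  · simp
  · refine Finset.sum_congr rfl fun k _ => ?_
    rw [pow_succ, mul_comm ((β : ℝ≥0∞) ^ k), mul_assoc]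
    rfl

lemma JPol_eq (x : ℤ) (y : ℝ≥0) :
    JPol q β γ π x y =
      ∫⁻ ω, ((∑' k, (β : ℝ≥0∞) ^ k * (dividend ω k : ℝ≥0∞)) + y) ^ γ ∂(law q π x) := by
  refine lintegral_congr_ae ?_
  filter_upwards [ae_dividend_eq_zero_of_ruin_le q π x] with ω hω
  congr 2
  refine tsum_congr fun k => ?_
  split_ifs with h
  · rfl
  · simp [hω k h]

lemma JPol_zero (x : ℤ) : JPol q β γ π x 0 = JhatPol q β γ π x := by
  simp [JPol_eq, JhatPol]

lemma J_zero (x : ℤ) : J q β γ x 0 = Jhat q β γ x := by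
  simp [J, Jhat, JPol_zero]

variable {γ} in
-- Monotone convergence reduces bounds to finite horizons, the only functionals
-- `lintegral_law_shift` covers.
lemma JPol_le_of_forall (hγ : 0 < γ) {x : ℤ} {y : ℝ≥0} {c : ℝ≥0∞}
    (h : ∀ n, ∫⁻ ω, (discounted β n ω + y) ^ γ ∂(law q π x) ≤ c) : JPol q β γ π x y ≤ c := by
  rw [JPol_eq]
  have h1 : ∀ ω : ℕ → AdmPair, ((∑' k, (β : ℝ≥0∞) ^ k * (dividend ω k : ℝ≥0∞)) + y) ^ γ =
      ⨆ n, (discounted β n ω + y) ^ γ := by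
    intro ω
    rw [tsum_eq_iSup_discounted, ENNReal.iSup_add]
    exact (ENNReal.orderIsoRpow γ hγ).map_iSup _
  simp only [h1]
  rw [lintegral_iSup]
  · exact iSup_le h
  · exact fun n => ((measurable_discounted β n).add_const _).pow_const _
  · intro n m hnm ω
    exact ENNReal.rpow_le_rpow (add_le_add_left (discounted_mono β ω hnm) _) hγ.le

lemma J_of_neg {x : ℤ} (hx : x < 0) (y : ℝ≥0) : J q β γ x y = (y : ℝ≥0∞) ^ γ := by
  have h : ∀ π, JPol q β γ π x y = (y : ℝ≥0∞) ^ γ := by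
    intro π
    rw [JPol_eq]
    have : ∀ᵐ ω ∂(law q π x), ((∑' k, (β : ℝ≥0∞) ^ k * (dividend ω k : ℝ≥0∞)) + y) ^ γ =
        (y : ℝ≥0∞) ^ γ := by
      filter_upwards [ae_surplus_neg_of_le q π x, ae_law_zero q π x] with ω hω h0
      have h1 : surplus ω 0 < 0 := by rw [surplus, h0]; exact hx
      have h2 : ∀ k, dividend ω k = 0 := fun k =>
        dividend_eq_zero_of_surplus_neg (hω 0 k (Nat.zero_le k) h1)
      simp [h2]
    rw [lintegral_congr_ae this, lintegral_const, measure_univ, mul_one]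
  -- Over an empty type the supremum of a constant would be 0.
  have : Nonempty Policy := ⟨piStar q β γ 0⟩
  simp [J, h]

variable {β γ} in
-- Factoring β out of the total turns a + y into the new offset (a+y)/β; from time 1 on, the shifted
-- policy earns at most J.
lemma JPol_le_bellman (hβ : 0 < β) (hγ : 0 < γ) {x : ℤ} (hx : 0 ≤ x) (y : ℝ≥0) :
    JPol q β γ π x y ≤ bellman q β γ x y (π.act 0 Fin.elim0 x) := by
  set a := π.act 0 Fin.elim0 x with ha
  set p := π.pair 0 Fin.elim0 x with hp
  have hβ0 : (β : ℝ≥0∞) ≠ 0 := by exact_mod_cast hβ.ne'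
  refine JPol_le_of_forall q β π hγ fun n => ?_
  calc ∫⁻ ω, (discounted β n ω + y) ^ γ ∂(law q π x)
      -- One extra period is split off as time 0, another keeps the shifted history nonempty.
      ≤ ∫⁻ ω, (discounted β (n + 2) ω + y) ^ γ ∂(law q π x) := by
        gcongr with ω
        exact discounted_mono β ω (Nat.le_add_right n 2)
    _ = ∫⁻ ω, (β : ℝ≥0∞) ^ γ * (discounted β (n + 1) (fun i => ω (i + 1))
          + ((a + y) / β : ℝ≥0)) ^ γ ∂(law q π x) := by
        refine lintegral_congr_ae ?_
        filter_upwards [ae_law_zero q π x] with ω hω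
        have hd : dividend ω 0 = a := by rw [dividend, hω]; rfl
        rw [← ENNReal.mul_rpow_of_nonneg _ _ hγ.le, discounted_succ, hd, mul_add]
        congr 1
        have : (β : ℝ≥0∞) * ((a + y) / β : ℝ≥0) = a + y := by
          rw [← ENNReal.coe_mul, mul_div_cancel₀ _ hβ.ne']
          simp
        rw [this]
        ring
    _ = (β : ℝ≥0∞) ^ γ * ∑' k, trans q p k * ∫⁻ ω, (discounted β (n + 1) ω
          + ((a + y) / β : ℝ≥0)) ^ γ ∂(law q (π.shift p) k) := by
        let g (h : Fin (n + 1) → AdmPair) : ℝ≥0∞ :=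
          ((∑ k : Fin (n + 1), (β : ℝ≥0∞) ^ (k : ℕ) * ((h k).1.2 : ℝ≥0∞))
            + ((a + y) / β : ℝ≥0)) ^ γ
        have hg : ∀ ω : ℕ → AdmPair, (discounted β (n + 1) ω
          + ((a + y) / β : ℝ≥0)) ^ γ = g (history (n + 1) ω) := fun ω => by
          simp only [g, discounted, Finset.sum_range]
          rfl
        rw [lintegral_const_mul' _ _ (by finiteness)]
        simp only [hg]
        rw [lintegral_law_shift q π x n g]
    _ ≤ (β : ℝ≥0∞) ^ γ * ∑' k, trans q p k * J q β γ k ((a + y) / β) := by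
        gcongr with k
        refine le_trans ?_ (le_iSup _ (π.shift p))
        rw [JPol_eq]
        gcongr with ω
        rw [tsum_eq_iSup_discounted]
        exact le_iSup (fun n => discounted β n ω) (n + 1)
    _ = bellman q β γ x y a := by
        rw [tsum_trans_mul_of_nonneg q (p := p) hx, bellman, G]
        congr 1
        exact tsum_congr fun k => mul_comm _ _

/-- A finite action set has a maximiser, so the `sup` in `fStar` is over a nonempty set and is
attained there. -/
lemma bellman_le_fStar (x : ℤ) (y : ℝ≥0) {a : ℕ} (ha : a ∈ actions x) :
    bellman q β γ x y a ≤ bellman q β γ x y (fStar q β γ x y) := by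
  classical
  obtain ⟨b, hb, hmax⟩ := Finset.exists_max_image (actions x) (bellman q β γ x y) ⟨a, ha⟩
  obtain ⟨c, hc, hceq⟩ := Finset.exists_mem_eq_sup
    ((actions x).filter fun a => ∀ b ∈ actions x, bellman q β γ x y b ≤ bellman q β γ x y a)
    ⟨b, Finset.mem_filter.2 ⟨hb, hmax⟩⟩ id
  have h : fStar q β γ x y = c := by
    unfold fStar
    convert! hceq
  rw [h]
  exact (Finset.mem_filter.1 hc).2 a ha

variable {β γ} in
/-- One half of the optimality equation. -/
lemma J_le_bellman_fStar (hβ : 0 < β) (hγ : 0 < γ) {x : ℤ} (hx : 0 ≤ x) (y : ℝ≥0) :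
    J q β γ x y ≤ bellman q β γ x y (fStar q β γ x y) :=
  iSup_le fun π => (JPol_le_bellman q π hβ hγ hx y).trans
    (bellman_le_fStar q β γ x y (π.act_mem _ _ _))

end

/-! ### Growth bounds, finiteness and the vanishing remainder. -/

section

variable (q : PMF ℤ) (β : ℝ≥0) (γ : ℝ) (π : Policy)

/-- The mean `𝔼 Z⁺` of the positive part of a claim. -/
def meanPos : ℝ≥0∞ := ∑' k : ℤ, q k * (k.toNat : ℝ≥0∞)

lemma tsum_trans_mul_toNat_le (p : AdmPair) :
    ∑' j, trans q p j * (j.toNat : ℝ≥0∞) ≤ p.1.1.toNat + meanPos q := by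
  rcases le_or_gt 0 p.1.1 with hp | hp
  · rw [tsum_trans_mul_of_nonneg q hp fun j => (j.toNat : ℝ≥0∞)]
    calc ∑' k, q k * ((p.1.1 - (p.1.2 : ℤ) + k).toNat : ℝ≥0∞)
        ≤ ∑' k, (q k * (p.1.1.toNat : ℝ≥0∞) + q k * (k.toNat : ℝ≥0∞)) := by
          refine ENNReal.tsum_le_tsum fun k => ?_
          rw [← mul_add]
          gcongr
          exact_mod_cast (by omega : (p.1.1 - (p.1.2 : ℤ) + k).toNat ≤ p.1.1.toNat + k.toNat)
      _ = p.1.1.toNat + meanPos q := by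
          rw [ENNReal.tsum_add, ENNReal.tsum_mul_right, q.tsum_coe, one_mul, meanPos]
  · rw [tsum_trans_mul_of_neg q hp fun j => (j.toNat : ℝ≥0∞)]
    exact le_self_add

lemma lintegral_surplus_le (x : ℤ) (n : ℕ) :
    ∫⁻ ω, ((surplus ω n).toNat : ℝ≥0∞) ∂(law q π x) ≤ x.toNat + n * meanPos q := by
  induction n with
  | zero =>
    refine (lintegral_law_zero q π x fun p => (p.1.1.toNat : ℝ≥0∞)).le.trans ?_
    simp [Policy.pair]
  | succ n ih =>
    calc ∫⁻ ω, ((surplus ω (n + 1)).toNat : ℝ≥0∞) ∂(law q π x)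
        = ∫⁻ ω, ∑' k, trans q (ω n) k * (k.toNat : ℝ≥0∞) ∂(law q π x) :=
          lintegral_law_succ q π x n fun _ p => (p.1.1.toNat : ℝ≥0∞)
      _ ≤ ∫⁻ ω, ((surplus ω n).toNat : ℝ≥0∞) + meanPos q ∂(law q π x) :=
          lintegral_mono fun ω => tsum_trans_mul_toNat_le q (ω n)
      _ ≤ (x.toNat + n * meanPos q) + meanPos q := by
          rw [lintegral_add_right _ measurable_const, lintegral_const, measure_univ, mul_one]
          gcongr
      _ = x.toNat + (n + 1 : ℕ) * meanPos q := by
          push_cast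
          ring

lemma rpow_le_one_add {γ : ℝ} (h0 : 0 ≤ γ) (h1 : γ ≤ 1) (u : ℝ≥0∞) : u ^ γ ≤ 1 + u := by
  rcases le_total u 1 with hu | hu
  · exact (ENNReal.rpow_le_one hu h0).trans le_self_add
  · exact ((ENNReal.rpow_le_rpow_of_exponent_le hu h1).trans (ENNReal.rpow_one u).le).trans
      le_add_self

variable {γ} in
-- Combine u^γ ≤ 1 + u with a_k ≤ x_k⁺ and E x_k⁺ ≤ x⁺ + k E Z⁺. The bound is uniform in the policy.
lemma Jhat_le (h0 : 0 ≤ γ) (h1 : γ ≤ 1) (x : ℤ) :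
    Jhat q β γ x ≤ 1 + ((∑' k : ℕ, (β : ℝ≥0∞) ^ k) * x.toNat
      + (∑' k : ℕ, (β : ℝ≥0∞) ^ k * k) * meanPos q) := by
  refine iSup_le fun π => ?_
  calc JhatPol q β γ π x
      ≤ ∫⁻ ω, 1 + ∑' k, (β : ℝ≥0∞) ^ k * (dividend ω k : ℝ≥0∞) ∂(law q π x) :=
        lintegral_mono fun ω => rpow_le_one_add h0 h1 _
    _ = 1 + ∑' k, (β : ℝ≥0∞) ^ k * ∫⁻ ω, (dividend ω k : ℝ≥0∞) ∂(law q π x) := by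
        rw [lintegral_add_left measurable_const, lintegral_const, measure_univ, mul_one,
          lintegral_tsum fun k => ((measurable_dividend k).const_mul _).aemeasurable]
        congr 1
        exact tsum_congr fun k => lintegral_const_mul _ (measurable_dividend k)
    _ ≤ 1 + ∑' k : ℕ, (β : ℝ≥0∞) ^ k * (x.toNat + k * meanPos q) := by
        gcongr with k
        refine le_trans (lintegral_mono fun ω => ?_) (lintegral_surplus_le q π x k)
        exact Nat.cast_le.2 (dividend_le_surplus ω k)
    _ = _ := by
        rw [← ENNReal.tsum_mul_right, ← ENNReal.tsum_mul_right, ← ENNReal.tsum_add]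
        congr 1
        exact tsum_congr fun k => by ring

lemma tsum_pow_ne_top {r : ℝ≥0} (hr : r < 1) : ∑' k : ℕ, (r : ℝ≥0∞) ^ k ≠ ⊤ := by
  rw [ENNReal.tsum_geometric]
  refine ENNReal.inv_ne_top.2 (tsub_pos_of_lt ?_).ne'
  exact_mod_cast hr

lemma tsum_pow_mul_ne_top {r : ℝ≥0} (hr : r < 1) : ∑' k : ℕ, (r : ℝ≥0∞) ^ k * k ≠ ⊤ := by
  have h : Summable fun k : ℕ => r ^ k * (k : ℝ≥0) := by
    rw [← NNReal.summable_coe]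
    have := summable_pow_mul_geometric_of_norm_lt_one (R := ℝ) 1 (r := r)
      (by simpa using hr)
    refine this.congr fun k => ?_
    push_cast
    ring
  have h2 := ENNReal.tsum_coe_ne_top_iff_summable.2 h
  simpa using h2

variable {β γ} in
lemma Jhat_lt_top (hq : meanPos q < ⊤) (hβ1 : β < 1) (h0 : 0 ≤ γ) (h1 : γ ≤ 1) (x : ℤ) :
    Jhat q β γ x < ⊤ := by
  refine (Jhat_le q β h0 h1 x).trans_lt ?_
  have := tsum_pow_ne_top hβ1
  have := tsum_pow_mul_ne_top hβ1
  finiteness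

/-- The value remaining after time `n` is asymptotically negligible, under every policy. -/
lemma tendsto_lintegral_Jhat_surplus (hq : meanPos q < ⊤) (hβ1 : β < 1)
    (h0 : 0 < γ) (h1 : γ ≤ 1) (x : ℤ) :
    Filter.Tendsto (fun n => ((β : ℝ≥0∞) ^ γ) ^ n *
      ∫⁻ ω, Jhat q β γ (surplus ω n) ∂(law q π x)) Filter.atTop (nhds 0) := by
  set C₁ : ℝ≥0∞ := ∑' k : ℕ, (β : ℝ≥0∞) ^ k with hC₁
  set C₂ : ℝ≥0∞ := ∑' k : ℕ, (β : ℝ≥0∞) ^ k * k with hC₂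
  have hC₁t : C₁ ≠ ⊤ := tsum_pow_ne_top hβ1
  have hC₂t : C₂ ≠ ⊤ := tsum_pow_mul_ne_top hβ1
  set r : ℝ≥0 := β ^ γ with hr
  have hr1 : r < 1 := NNReal.rpow_lt_one hβ1 h0
  have hrc : (β : ℝ≥0∞) ^ γ = r := (ENNReal.coe_rpow_of_nonneg _ h0.le).symm
  -- Both r^n and n r^n tend to 0 as terms of convergent series; they beat the linear growth of the
  -- mean.
  have ht₁ := ENNReal.tendsto_atTop_zero_of_tsum_ne_top (tsum_pow_ne_top hr1)
  have ht₂ := ENNReal.tendsto_atTop_zero_of_tsum_ne_top (tsum_pow_mul_ne_top hr1)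
  have hA : 1 + (C₁ * x.toNat + C₂ * meanPos q) ≠ ⊤ := by finiteness
  have hB : C₁ * meanPos q ≠ ⊤ := by finiteness
  have ht := (ENNReal.Tendsto.mul_const ht₁ (Or.inr hA)).add
    (ENNReal.Tendsto.mul_const ht₂ (Or.inr hB))
  simp only [zero_mul, add_zero] at ht
  refine tendsto_of_tendsto_of_tendsto_of_le_of_le tendsto_const_nhds ht
    (fun _ => zero_le) fun n => ?_
  have hm : Measurable fun ω : ℕ → AdmPair => ((surplus ω n).toNat : ℝ≥0∞) :=
    (Measurable.of_discrete (f := fun p : AdmPair => (p.1.1.toNat : ℝ≥0∞))).comp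
      (measurable_pi_apply n)
  calc ((β : ℝ≥0∞) ^ γ) ^ n * ∫⁻ ω, Jhat q β γ (surplus ω n) ∂(law q π x)
      ≤ (r : ℝ≥0∞) ^ n * ∫⁻ ω, (1 + C₂ * meanPos q) + C₁ * (surplus ω n).toNat ∂(law q π x) := by
        rw [hrc]
        gcongr with ω
        refine (Jhat_le q β h0.le h1 _).trans (le_of_eq ?_)
        ring
    _ ≤ (r : ℝ≥0∞) ^ n * ((1 + C₂ * meanPos q) + C₁ * (x.toNat + n * meanPos q)) := by
        rw [lintegral_add_left measurable_const, lintegral_const, measure_univ, mul_one,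
          lintegral_const_mul _ hm]
        gcongr
        exact lintegral_surplus_le q π x n
    _ = (r : ℝ≥0∞) ^ n * (1 + (C₁ * x.toNat + C₂ * meanPos q))
          + (r : ℝ≥0∞) ^ n * n * (C₁ * meanPos q) := by ring

/-! ### Accumulated dividends and optimality of π*. -/

lemma accum_zero_eq {β : ℝ≥0} (hβ : β ≠ 0) (k : ℕ) (h : Fin k → AdmPair) :
    accum β 0 k h = (∑ m : Fin k, β ^ (m : ℕ) * ((h m).1.2 : ℝ≥0)) / β ^ k := by
  induction k with
  | zero => simp [accum]
  | succ k ih =>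
    rw [accum, ih, Fin.sum_univ_castSucc]
    simp only [Fin.val_castSucc, Fin.val_last]
    field_simp
    ring

lemma accum_succ_history (y₀ : ℝ≥0) (n : ℕ) (ω : ℕ → AdmPair) :
    accum β y₀ (n + 1) (history (n + 1) ω) =
      (accum β y₀ n (history n ω) + (dividend ω n : ℝ≥0)) / β := rfl

lemma accum_zero_history {β : ℝ≥0} (hβ : β ≠ 0) (n : ℕ) (ω : ℕ → AdmPair) :
    accum β 0 n (history n ω) =
      (∑ m ∈ Finset.range n, β ^ m * (dividend ω m : ℝ≥0)) / β ^ n := by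
  rw [accum_zero_eq hβ, Finset.sum_range]
  rfl

lemma pow_mul_accum {β : ℝ≥0} (hβ : β ≠ 0) (n : ℕ) (ω : ℕ → AdmPair) :
    (β : ℝ≥0∞) ^ n * accum β 0 n (history n ω) = discounted β n ω := by
  rw [accum_zero_history hβ, ← ENNReal.coe_pow, ← ENNReal.coe_mul,
    mul_div_cancel₀ _ (pow_ne_zero n hβ), discounted]
  push_cast
  rfl

lemma J_le_add (h0 : 0 ≤ γ) (h1 : γ ≤ 1) (x : ℤ) (y : ℝ≥0) :
    J q β γ x y ≤ (y : ℝ≥0∞) ^ γ + Jhat q β γ x := by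
  refine iSup_le fun π => ?_
  rw [JPol_eq]
  calc ∫⁻ ω, ((∑' k, (β : ℝ≥0∞) ^ k * (dividend ω k : ℝ≥0∞)) + y) ^ γ ∂(law q π x)
      ≤ ∫⁻ ω, (y : ℝ≥0∞) ^ γ
          + (∑' k, (β : ℝ≥0∞) ^ k * (dividend ω k : ℝ≥0∞)) ^ γ ∂(law q π x) := by
        gcongr with ω
        rw [add_comm ((y : ℝ≥0∞) ^ γ)]
        exact ENNReal.rpow_add_le_add_rpow _ _ h0 h1
    _ = (y : ℝ≥0∞) ^ γ + JhatPol q β γ π x := by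
        rw [lintegral_add_left measurable_const, lintegral_const, measure_univ, mul_one, JhatPol]
    _ ≤ _ := by
        gcongr
        exact le_iSup (fun π => JhatPol q β γ π x) π

lemma ae_dividend_piStar (y₀ : ℝ≥0) (x : ℤ) :
    ∀ᵐ ω ∂(law q (piStar q β γ y₀) x), ∀ n,
      dividend ω n = fStar q β γ (surplus ω n) (accum β y₀ n (history n ω)) := by
  refine ae_all_iff.2 fun n => ?_
  filter_upwards [ae_law_eq_pair q (piStar q β γ y₀) x n] with ω hω
  rw [dividend, hω]
  rfl

variable {β γ} in
/-- Under `π*` the discounted value process has nondecreasing mean. -/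
lemma Jhat_le_lintegral_J (hβ : 0 < β) (hγ : 0 < γ) (x : ℤ) (n : ℕ) :
    Jhat q β γ x ≤ ∫⁻ ω, ((β : ℝ≥0∞) ^ γ) ^ n *
      J q β γ (surplus ω n) (accum β 0 n (history n ω)) ∂(law q (piStar q β γ 0) x) := by
  induction n with
  | zero =>
    refine le_of_eq ?_
    have h := lintegral_law_zero q (piStar q β γ 0) x fun p => J q β γ p.1.1 0
    simp only [pow_zero, one_mul, accum, ← J_zero]
    exact h.symm
  | succ n ih =>
    refine ih.trans ?_
    have h := lintegral_law_succ q (piStar q β γ 0) x n fun h p =>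
      ((β : ℝ≥0∞) ^ γ) ^ (n + 1) * J q β γ p.1.1 (accum β 0 (n + 1) h)
    refine le_trans (lintegral_mono_ae ?_) h.ge
    filter_upwards [ae_dividend_piStar q β γ 0 x] with ω hω
    set y := accum β 0 n (history n ω) with hy
    have hβγ : (β : ℝ≥0∞) ^ γ * (((y / β : ℝ≥0) : ℝ≥0∞)) ^ γ = (y : ℝ≥0∞) ^ γ := by
      rw [← ENNReal.mul_rpow_of_nonneg _ _ hγ.le, ← ENNReal.coe_mul, mul_div_cancel₀ _ hβ.ne']
    calc ((β : ℝ≥0∞) ^ γ) ^ n * J q β γ (surplus ω n) y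
        ≤ ((β : ℝ≥0∞) ^ γ) ^ n * ((β : ℝ≥0∞) ^ γ * ∑' k, trans q (ω n) k *
            J q β γ k ((y + (dividend ω n : ℝ≥0)) / β)) := by
          gcongr
          -- Before ruin, use the half optimality equation at the action π* takes. After ruin J is
          -- y^γ, and replacing y by y/β exactly cancels the factor β^γ.
          rcases le_or_gt 0 (surplus ω n) with hs | hs
          · refine (J_le_bellman_fStar q hβ hγ hs y).trans (le_of_eq ?_)
            rw [← hω n, bellman, G, tsum_trans_mul_of_nonneg q (p := ω n) hs, add_comm y]
            congr 1
            exact tsum_congr fun k => mul_comm _ _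
          · rw [tsum_trans_mul_of_neg q (p := ω n) hs, J_of_neg q β γ hs,
              J_of_neg q β γ (x := (ω n).1.1) hs, dividend_eq_zero_of_surplus_neg hs]
            simp only [Nat.cast_zero, add_zero]
            exact hβγ.ge
      _ = ∑' k, trans q (ω n) k * (((β : ℝ≥0∞) ^ γ) ^ (n + 1) *
            J q β γ k (accum β 0 (n + 1) (history (n + 1) ω))) := by
          rw [accum_succ_history, ← mul_assoc, ← pow_succ, ← ENNReal.tsum_mul_left]
          exact tsum_congr fun k => by ring

variable {β γ} in
lemma Jhat_le_JhatPol_piStar (hq : meanPos q < ⊤) (hβ : 0 < β) (hβ1 : β < 1)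
    (h0 : 0 < γ) (h1 : γ ≤ 1) (x : ℤ) :
    Jhat q β γ x ≤ JhatPol q β γ (piStar q β γ 0) x := by
  have ht := (tendsto_const_nhds (x := JhatPol q β γ (piStar q β γ 0) x)).add
    (tendsto_lintegral_Jhat_surplus q β γ (piStar q β γ 0) hq hβ1 h0 h1 x)
  rw [add_zero] at ht
  refine ge_of_tendsto' ht fun n => (Jhat_le_lintegral_J q hβ h0 x n).trans ?_
  have hm : Measurable fun ω : ℕ → AdmPair => Jhat q β γ (surplus ω n) :=
    (Measurable.of_discrete (f := fun p : AdmPair => Jhat q β γ p.1.1)).comp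
      (measurable_pi_apply n)
  calc ∫⁻ ω, ((β : ℝ≥0∞) ^ γ) ^ n *
        J q β γ (surplus ω n) (accum β 0 n (history n ω)) ∂(law q (piStar q β γ 0) x)
      ≤ ∫⁻ ω, (∑' k, (β : ℝ≥0∞) ^ k * (dividend ω k : ℝ≥0∞)) ^ γ
          + ((β : ℝ≥0∞) ^ γ) ^ n * Jhat q β γ (surplus ω n) ∂(law q (piStar q β γ 0) x) := by
        refine lintegral_mono fun ω => ?_
        refine (mul_le_mul_right (J_le_add q β γ h0.le h1 _ _) _).trans ?_
        rw [mul_add]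
        gcongr
        -- Moving β^n inside the power turns y_n into the dividends discounted up to time n, a
        -- partial sum of the full series.
        have : ((β : ℝ≥0∞) ^ γ) ^ n = ((β : ℝ≥0∞) ^ n) ^ γ := by
          rw [← ENNReal.rpow_natCast, ← ENNReal.rpow_mul, mul_comm, ENNReal.rpow_mul,
            ENNReal.rpow_natCast]
        rw [this, ← ENNReal.mul_rpow_of_nonneg _ _ h0.le, pow_mul_accum hβ.ne',
          tsum_eq_iSup_discounted]
        exact ENNReal.rpow_le_rpow (le_iSup (fun n => discounted β n ω) n) h0.le
    _ = _ := by
        rw [lintegral_add_right _ (hm.const_mul _), lintegral_const_mul _ hm, JhatPol]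

end

end Dividend

end

open Dividend in
theorem mainTheorem9 (q : PMF ℤ) (hA1 : ∑' k : ℤ, q k * (k.toNat : ℝ≥0∞) < ⊤)
    (hA2 : 0 < q.toMeasure {k : ℤ | k < 0})
    (β : ℝ≥0) (hβ0 : 0 < β) (hβ1 : β < 1) (γ : ℝ) (hγ0 : 0 < γ) (hγ1 : γ < 1) :
    (∀ x : ℤ, Jhat q β γ x < ⊤ ∧ Jhat q β γ x = JhatPol q β γ (piStar q β γ 0) x) ∧
    (∀ (k : ℕ) (h : Fin k → AdmPair) (x : ℤ),
      (piStar q β γ 0).act k h x =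
        fStar q β γ x ((∑ m : Fin k, β ^ (m : ℕ) * ((h m).1.2 : ℝ≥0)) / β ^ k)) ∧
    (∀ x : ℤ, ∀ᵐ ω ∂(law q (piStar q β γ 0) x), ∃ y : ℕ → ℝ≥0,
      y 0 = 0 ∧ ∀ k : ℕ,
        dividend ω k = fStar q β γ (surplus ω k) (y k) ∧
        y (k + 1) = (y k + (fStar q β γ (surplus ω k) (y k) : ℝ≥0)) / β ∧
        y k = (∑ m ∈ Finset.range k, β ^ m * (dividend ω m : ℝ≥0)) / β ^ k) := by
  have hq : meanPos q < ⊤ := hA1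
  refine ⟨fun x => ⟨Jhat_lt_top q hq hβ1 hγ0.le hγ1.le x, ?_⟩, fun k h x => ?_, fun x => ?_⟩
  · exact le_antisymm (Jhat_le_JhatPol_piStar q hq hβ0 hβ1 hγ0 hγ1.le x)
      (le_iSup (fun π => JhatPol q β γ π x) (piStar q β γ 0))
  · change fStar q β γ x (accum β 0 k h) = _
    rw [accum_zero_eq hβ0.ne']
  · filter_upwards [ae_dividend_piStar q β γ 0 x] with ω hω
    refine ⟨fun n => accum β 0 n (history n ω), rfl, fun k => ⟨hω k, ?_, ?_⟩⟩
    · beta_reduce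
      rw [accum_succ_history, ← hω k]
    · exact accum_zero_history hβ0.ne' k ω
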